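/- The base field is $\mathbb C$. Let $\mathfrak{sl}(\infty)=\varinjlim \mathfrak{sl}(n)$ along the embeddings $A\mapsto\mathrm{diag}(A,0)$. A homomorphism $\mathfrak{sl}(n)\to\mathfrak{sl}(m)$ has signature $(l,r,z)$ if the natural module $\mathbb C^m$, restricted to $\mathfrak{sl}(n)$, is isomorphic to the direct sum of $l$ copies of $\mathbb C^n$, $r$ copies of its dual and $z$ copies of the trivial one-dimensional module. A diagonal Lie algebra $\mathfrak s$ of type $A$ is a Lie algebra that is the union of a chain of subalgebras $\mathfrak s_1\subset\mathfrak s_2\subset\cdots$ with isomorphisms $\mathfrak s_i\cong\mathfrak{sl}(n_i)$ such that each inclusion $\mathfrak s_i\subset\mathfrak s_{i+1}$ has some signature $(l_i,r_i,z_i)$ with $l_i\ge r_i$ and $l_i>0$, normalised by $n_1=1$, $l_1=n_2\geq 2$, $r_1=z_1=0$. Put $s_i=l_i+r_i$, $c_i=l_i-r_i$ and $\delta_i=s_1\cdots s_{i-1}/n_i$. The algebra $\mathfrak s$ is pure and one-sided if the chain can be chosen so that $\delta_i$ is eventually constant and nonzero and $c_i=s_i$ for all large $i$. A Steinitz number is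 a formal product $\prod_p p^{\alpha_p}$ over the primes with $\alpha_p\in\{0,1,2,\dots,\infty\}$; it is infinite if it is not a positive integer. For a sequence $s_1,s_2,\dots$ of positive integers with product $\Pi=\prod_i s_i$ (as a Steinitz number), $\mathfrak{sl}(\Pi)$ is the direct limit of $\mathfrak{sl}(1)\to\mathfrak{sl}(s_1)\to\mathfrak{sl}(s_1s_2)\to\cdots$, where the $k$-th map is the block diagonal embedding $A\mapsto\mathrm{diag}(A,\dots,A)$ with $s_k$ blocks. \textbf{Proposition.} $\mathfrak{sl}(\infty)$ admits an injective Lie algebra homomorphism into every infinite-dimensional pure one-sided Lie algebra of type $A$. In particular, for every infinite Steinitz number $\Pi$ and every sequence of positive integers with product $\Pi$, it admits an injective homomorphism into the Lie algebra $\mathfrak{sl}(\Pi)$ built from that sequence. -/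

import Mathlib

attribute [local instance 100] LieRing.ofAssociativeRing

open LieAlgebra.SpecialLinear

/-! ### Direct limits of sequences of Lie algebras -/

section LieSeqLimit

/-- A sequence of complex Lie algebras `G 0 → G 1 → G 2 → ⋯` with its connecting
homomorphisms: the composite `G m → G n` of the steps, for `m ≤ n`. -/
def seqTrans {G : ℕ → Type*} [∀ k, LieRing (G k)] [∀ k, LieAlgebra ℂ (G k)]
    (f : ∀ k, G k →ₗ⁅ℂ⁆ G (k + 1)) (m n : ℕ) (h : m ≤ n) : G m →ₗ⁅ℂ⁆ G n :=
  Nat.leRec (motive := fun n _ => G m →ₗ⁅ℂ⁆ G n) LieHom.id (fun k _ g => (f k).comp g) h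

instance seqTrans_directedSystem {G : ℕ → Type*} [∀ k, LieRing (G k)]
    [∀ k, LieAlgebra ℂ (G k)] (f : ∀ k, G k →ₗ⁅ℂ⁆ G (k + 1)) :
    DirectedSystem G (fun i j h => (seqTrans f i j h : G i → G j)) where
  map_self i x := by simp [seqTrans]
  map_map k j i hij hjk x := by
    induction hjk using Nat.leRec with
    | refl => simp [seqTrans]
    | le_succ_of_le hk ih =>
      simp only [seqTrans] at ih ⊢
      rw [Nat.leRec_succ (h1 := hk), Nat.leRec_succ (h1 := hij.trans hk)]
      simp only [LieHom.comp_apply, ih]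

/-- The direct limit of a sequence `G 0 → G 1 → G 2 → ⋯` of complex Lie algebras. The underlying
vector space is the direct limit of the vector spaces `G k`. -/
def LieSeqLimit {G : ℕ → Type*} [∀ k, LieRing (G k)] [∀ k, LieAlgebra ℂ (G k)]
    (f : ∀ k, G k →ₗ⁅ℂ⁆ G (k + 1)) : Type _ :=
  DirectLimit G (seqTrans f)

namespace LieSeqLimit

variable {G : ℕ → Type*} [∀ k, LieRing (G k)] [∀ k, LieAlgebra ℂ (G k)]
  (f : ∀ k, G k →ₗ⁅ℂ⁆ G (k + 1))

noncomputable instance : AddCommGroup (LieSeqLimit f) :=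
  inferInstanceAs (AddCommGroup (DirectLimit G (seqTrans f)))

noncomputable instance : Module ℂ (LieSeqLimit f) :=
  inferInstanceAs (Module ℂ (DirectLimit G (seqTrans f)))

/-- The bracket is induced by the brackets of the algebras `G k`. -/
noncomputable instance : Bracket (LieSeqLimit f) (LieSeqLimit f) where
  bracket := DirectLimit.map₂ (seqTrans f) (seqTrans f) (seqTrans f)
    (fun _ x y => ⁅x, y⁆) (fun i j h x y => LieHom.map_lie (seqTrans f i j h) x y)

/-- The class of `x : G k` in the limit. -/
def mk (k : ℕ) (x : G k) : LieSeqLimit f := (⟦⟨k, x⟩⟧ : DirectLimit G (seqTrans f))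

theorem mk_lie (k : ℕ) (x y : G k) : ⁅mk f k x, mk f k y⁆ = mk f k ⁅x, y⁆ :=
  DirectLimit.map₂_def ..

theorem mk_add (k : ℕ) (x y : G k) : mk f k x + mk f k y = mk f k (x + y) :=
  DirectLimit.add_def ..

theorem mk_smul (k : ℕ) (c : ℂ) (x : G k) : c • mk f k x = mk f k (c • x) := rfl

theorem mk_zero (k : ℕ) : (0 : LieSeqLimit f) = mk f k 0 := DirectLimit.zero_def ..

noncomputable instance : LieRing (LieSeqLimit f) where
  add_lie := DirectLimit.induction₃ _ fun k x y z => by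
    change ⁅mk f k x + mk f k y, mk f k z⁆ = ⁅mk f k x, mk f k z⁆ + ⁅mk f k y, mk f k z⁆
    simp only [mk_add, mk_lie, add_lie]
  lie_add := DirectLimit.induction₃ _ fun k x y z => by
    change ⁅mk f k x, mk f k y + mk f k z⁆ = ⁅mk f k x, mk f k y⁆ + ⁅mk f k x, mk f k z⁆
    simp only [mk_add, mk_lie, lie_add]
  lie_self := DirectLimit.induction _ fun k x => by
    change ⁅mk f k x, mk f k x⁆ = 0
    rw [mk_lie, lie_self, mk_zero f k]
  leibniz_lie := DirectLimit.induction₃ _ fun k x y z => by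
    change ⁅mk f k x, ⁅mk f k y, mk f k z⁆⁆ =
      ⁅⁅mk f k x, mk f k y⁆, mk f k z⁆ + ⁅mk f k y, ⁅mk f k x, mk f k z⁆⁆
    simp only [mk_add, mk_lie]
    rw [leibniz_lie]

noncomputable instance : LieAlgebra ℂ (LieSeqLimit f) where
  lie_smul c := DirectLimit.induction₂ _ fun k x y => by
    change ⁅mk f k x, c • mk f k y⁆ = c • ⁅mk f k x, mk f k y⁆
    simp only [mk_smul, mk_lie, lie_smul]

end LieSeqLimit

end LieSeqLimit

/-! ### The algebras `sl(∞)` and `sl(Π)` -/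

/-- The homomorphism `sl(n) → sl(n + 1)` of signature `(1, 0, 1)`: a matrix `A` is sent to
the block diagonal matrix `diag(A, 0)`. -/
def slCorner (n : ℕ) : sl (Fin n) ℂ →ₗ⁅ℂ⁆ sl (Fin (n + 1)) ℂ where
  toFun A := ⟨Matrix.reindex finSumFinEquiv finSumFinEquiv
      (Matrix.fromBlocks A.1 0 0 (0 : Matrix (Fin 1) (Fin 1) ℂ)), by
    have h : Matrix.trace A.1 = 0 := A.2
    change (∑ i : Fin (n + 1), _) = (0 : ℂ)
    simp [← Equiv.sum_comp (finSumFinEquiv : Fin n ⊕ Fin 1 ≃ Fin (n + 1))]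
    exact h⟩
  map_add' A B := Subtype.ext <| by
    ext i j
    obtain ⟨i, rfl⟩ := (finSumFinEquiv : Fin n ⊕ Fin 1 ≃ Fin (n + 1)).surjective i
    obtain ⟨j, rfl⟩ := (finSumFinEquiv : Fin n ⊕ Fin 1 ≃ Fin (n + 1)).surjective j
    rcases i with i | i <;> rcases j with j | j <;> simp [Matrix.add_apply,
        -finSumFinEquiv_apply_left, -finSumFinEquiv_apply_right]
  map_smul' c A := Subtype.ext <| by
    ext i j
    obtain ⟨i, rfl⟩ := (finSumFinEquiv : Fin n ⊕ Fin 1 ≃ Fin (n + 1)).surjective i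
    obtain ⟨j, rfl⟩ := (finSumFinEquiv : Fin n ⊕ Fin 1 ≃ Fin (n + 1)).surjective j
    rcases i with i | i <;> rcases j with j | j <;> simp [Matrix.smul_apply,
        -finSumFinEquiv_apply_left, -finSumFinEquiv_apply_right]
  map_lie' {A B} := Subtype.ext <| by
    simp only [sl_bracket, Matrix.reindex_apply, Matrix.submatrix_mul_equiv,
      Matrix.fromBlocks_multiply]
    ext i j
    obtain ⟨i, rfl⟩ := (finSumFinEquiv : Fin n ⊕ Fin 1 ≃ Fin (n + 1)).surjective i
    obtain ⟨j, rfl⟩ := (finSumFinEquiv : Fin n ⊕ Fin 1 ≃ Fin (n + 1)).surjective j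
    rcases i with i | i <;> rcases j with j | j <;> simp [Matrix.sub_apply,
        -finSumFinEquiv_apply_left, -finSumFinEquiv_apply_right]

/-- `sl(∞)`, the union of `sl(1) ⊂ sl(2) ⊂ sl(3) ⊂ ⋯` (with `sl(0) = 0` put in front). -/
abbrev SlInfinity : Type := LieSeqLimit slCorner

/-- The homomorphism `sl(n) → sl(n * s)` of signature `(s, 0, 0)`: a matrix `A` is sent to a matrix
that is, up to the order of the basis, the block diagonal matrix `diag(A, …, A)`
with `s` blocks. -/
def slBlock (n s : ℕ) : sl (Fin n) ℂ →ₗ⁅ℂ⁆ sl (Fin (n * s)) ℂ where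
  toFun A := ⟨Matrix.reindex finProdFinEquiv finProdFinEquiv
      (Matrix.blockDiagonal fun _ : Fin s => A.1), by
    have h : Matrix.trace A.1 = 0 := A.2
    change (∑ i : Fin (n * s), _) = (0 : ℂ)
    rw [← Equiv.sum_comp (finProdFinEquiv : Fin n × Fin s ≃ Fin (n * s)),
      Fintype.sum_prod_type_right]
    refine Finset.sum_eq_zero fun j _ => Eq.trans (Finset.sum_congr rfl fun i _ => ?_) h
    simp [Matrix.blockDiagonal_apply, -finProdFinEquiv_apply_val]⟩
  map_add' A B := Subtype.ext <| by
    ext i j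
    simp only [Matrix.reindex_apply, Matrix.submatrix_apply, Matrix.blockDiagonal_apply,
      AddMemClass.coe_add, Matrix.add_apply]
    split_ifs <;> simp
  map_smul' c A := Subtype.ext <| by
    ext i j
    simp only [Matrix.reindex_apply, Matrix.submatrix_apply, Matrix.blockDiagonal_apply,
      SetLike.val_smul, Matrix.smul_apply, RingHom.id_apply]
    split_ifs <;> simp
  map_lie' {A B} := Subtype.ext <| by
    simp only [sl_bracket, Matrix.reindex_apply, Matrix.submatrix_mul_equiv,
      ← Matrix.blockDiagonal_mul]
    ext i j
    simp only [Matrix.submatrix_apply, Matrix.blockDiagonal_apply, Matrix.sub_apply]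
    split_ifs <;> simp

/-- The partial products `s 0 * s 1 * ⋯ * s (k - 1)`. -/
def partialProd (s : ℕ → ℕ) : ℕ → ℕ
  | 0 => 1
  | k + 1 => partialProd s k * s k

/-- A Steinitz number `∏ p ^ α p`, given by its exponents `α p ∈ {0, 1, 2, …, ∞}`. -/
abbrev Steinitz : Type := Nat.Primes → ℕ∞

/-- A positive integer considered as a Steinitz number. -/
def Steinitz.ofNat (n : ℕ) : Steinitz := fun p => (padicValNat p n : ℕ∞)

/-- A Steinitz number is infinite if it is not a positive integer. -/
def Steinitz.IsInfinite (P : Steinitz) : Prop := ¬ ∃ n : ℕ, 0 < n ∧ P = Steinitz.ofNat n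

/-- The infinite product `s 0 * s 1 * s 2 * ⋯` of positive integers as a Steinitz number. -/
noncomputable def stz (s : ℕ → ℕ) : Steinitz :=
  fun p => ⨆ k : ℕ, (padicValNat p (partialProd s k) : ℕ∞)

/-- The homomorphism `sl(s 0 * ⋯ * s (k - 1)) → sl(s 0 * ⋯ * s k)` of signature `(s k, 0, 0)`. -/
def slStep (s : ℕ → ℕ) (k : ℕ) :
    sl (Fin (partialProd s k)) ℂ →ₗ⁅ℂ⁆ sl (Fin (partialProd s (k + 1))) ℂ :=
  slBlock (partialProd s k) (s k)

/-- The Lie algebra `sl(Stz(s))` of a sequence `s` of positive integers: the direct limit of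
`sl(1) → sl(s 0) → sl(s 0 * s 1) → ⋯`. -/
abbrev SlStz (s : ℕ → ℕ) : Type := LieSeqLimit (slStep s)

/-! ### Diagonal Lie algebras of type `A` -/

/-- A homomorphism `φ : sl(n) → sl(m)` is diagonal of signature `(l, r, z)` if the restriction of
the natural module `ℂ ^ m` along `φ` is isomorphic, as an `sl(n)`-module, to the direct
sum of `l` copies of the natural module `ℂ ^ n`, `r` copies of its dual (on which `x` acts by
`-xᵀ` in coordinates), and `z` copies of the trivial module `ℂ`. -/
def HasSignature {n m : ℕ} (φ : sl (Fin n) ℂ →ₗ⁅ℂ⁆ sl (Fin m) ℂ) (l r z : ℕ) : Prop :=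
  ∃ e : (Fin m → ℂ) ≃ₗ[ℂ] (Fin l → Fin n → ℂ) × (Fin r → Fin n → ℂ) × (Fin z → ℂ),
    ∀ (x : sl (Fin n) ℂ) (v : Fin m → ℂ),
      e (Matrix.mulVec (φ x).1 v) =
        (fun a => Matrix.mulVec x.1 ((e v).1 a),
         fun b => -Matrix.mulVec x.1.transpose ((e v).2.1 b),
         0)

/-- A sequence of signatures `(l i, r i, z i)`, normalised so that the exhaustion starts with
`sl(1) = 0`, and with `r i ≤ l i`. -/
structure TripleSeq where
  l : ℕ → ℕ
  r : ℕ → ℕ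
  z : ℕ → ℕ
  l_pos : ∀ i, 0 < l i
  r_le_l : ∀ i, r i ≤ l i
  two_le_l_zero : 2 ≤ l 0
  r_zero : r 0 = 0
  z_zero : z 0 = 0

namespace TripleSeq

/-- `n i` is the dimension of the natural module of the `i`-th algebra: `n 0 = 1` and
`n (i + 1) = (l i + r i) * n i + z i`. -/
def n (T : TripleSeq) : ℕ → ℕ
  | 0 => 1
  | i + 1 => (T.l i + T.r i) * T.n i + T.z i

/-- `s i = l i + r i`. -/
def s (T : TripleSeq) (i : ℕ) : ℕ := T.l i + T.r i

/-- `c i = l i - r i`. -/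
def c (T : TripleSeq) (i : ℕ) : ℤ := (T.l i : ℤ) - (T.r i : ℤ)

/-- `δ i = s 0 * ⋯ * s (i - 1) / n i`. -/
def delta (T : TripleSeq) (i : ℕ) : ℚ := (partialProd T.s i : ℚ) / (T.n i : ℚ)

/-- The sequence `δ` is eventually constant and nonzero. -/
def IsPure (T : TripleSeq) : Prop := ∃ i, ∀ j, i < j → T.delta j = T.delta i ∧ T.delta i ≠ 0

/-- `c j = s j` for all large `j`. -/
def IsOneSided (T : TripleSeq) : Prop := ∃ i, ∀ j, i ≤ j → T.c j = (T.s j : ℤ)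

/-- `L` is the diagonal Lie algebra `A(T)`: it has an exhaustion `𝔰 0 ⊂ 𝔰 1 ⊂ ⋯` by
subalgebras `𝔰 i ≅ sl(n i)` such that the inclusion `𝔰 i ⊂ 𝔰 (i + 1)` is diagonal of
signature `(l i, r i, z i)`. -/
def Realizes (T : TripleSeq) (L : Type*) [LieRing L] [LieAlgebra ℂ L] : Prop :=
  ∃ (𝔰 : ℕ → LieSubalgebra ℂ L) (h𝔰 : ∀ i, 𝔰 i ≤ 𝔰 (i + 1))
    (e : ∀ i, sl (Fin (T.n i)) ℂ ≃ₗ⁅ℂ⁆ 𝔰 i),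
    (∀ x : L, ∃ i, x ∈ 𝔰 i) ∧
    ∀ i, HasSignature
      (((e (i + 1)).symm.toLieHom.comp (LieSubalgebra.inclusion (h𝔰 i))).comp (e i).toLieHom)
      (T.l i) (T.r i) (T.z i)

end TripleSeq

/-- `L` is a pure one-sided (diagonal) Lie algebra of type `A`. -/
def IsPureOneSidedTypeA (L : Type*) [LieRing L] [LieAlgebra ℂ L] : Prop :=
  ∃ T : TripleSeq, T.IsPure ∧ T.IsOneSided ∧ T.Realizes L

/-! ### Weights on the unit interval with rational moments -/

section Moments

open Polynomial

/-! In both cases a tail of the chain consists of algebras `sl(n i)` with unbounded `n i` and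
inclusions of signature `(s i, 0, 0)`, so `n i ∣ n (i + 1)`. Embed `sl(k)` into `sl(n (i k))` so
that the natural module restricts to the sum of `a k j` copies of `Λ^j(ℂ^k)`. Since `Λ^j(ℂ^(k+1))`
restricts to `Λ^j(ℂ^k) ⊕ Λ^(j-1)(ℂ^k)`, successive embeddings are compatible as soon as `p k j = a k
j / n (i k)` satisfies `p (k+1) j + p (k+1) (j+1) = p k j`.

This recursion is solved by the Hausdorff moments `p k j = ∫ x^j (1-x)^(k-j) w(x) dx` over `[0, 1]`.
It remains to find positive weights for which `n (i k)` clears the denominators. Starting from `w =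
1`, the moment of order `k + 1` is rounded by a perturbation that leaves the lower moments alone; it
is small enough to preserve positivity because `n` is unbounded.

`exists_multiplicities` supplies the numbers, `Fock.exists_branching` and `Fock.Models.exists_succ`
turn them into compatible embeddings, and `exists_injective_of_isMultiple` passes to the limit. -/

theorem exists_continuous_moments (k : ℕ) : ∃ e : ℝ → ℝ, Continuous e ∧
    (∀ j ≤ k, ∫ x in (0 : ℝ)..1, x ^ j * e x = 0) ∧ ∫ x in (0 : ℝ)..1, x ^ (k + 1) * e x = 1 := by
  let m (j : ℕ) : ℝ[X] →ₗ[ℝ] ℝ :=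
    { toFun := fun p => ∫ x in (0 : ℝ)..1, x ^ j * p.eval x
      map_add' := fun p q => by
        simp only [eval_add, mul_add]
        exact intervalIntegral.integral_add (Continuous.intervalIntegrable (by fun_prop) _ _)
          (Continuous.intervalIntegrable (by fun_prop) _ _)
      map_smul' := fun c p => by
        simp only [eval_smul, smul_eq_mul, RingHom.id_apply, mul_left_comm _ c]
        exact intervalIntegral.integral_const_mul _ _ }
  by_cases h : ∃ p : ℝ[X], (∀ j : Fin (k + 1), m j p = 0) ∧ m (k + 1) p ≠ 0
  · obtain ⟨p, h0, h1⟩ := h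
    refine ⟨fun x => (m (k + 1) p)⁻¹ * p.eval x, by fun_prop, fun j hj => ?_, ?_⟩
    · have := h0 ⟨j, Nat.lt_succ_of_le hj⟩
      simp only [mul_left_comm _ (m (k + 1) p)⁻¹, intervalIntegral.integral_const_mul]
      exact mul_eq_zero_of_right _ this
    · simp only [mul_left_comm _ (m (k + 1) p)⁻¹, intervalIntegral.integral_const_mul]
      exact inv_mul_cancel₀ h1
  · push Not at h
    exfalso
    -- If the order `k + 1` moment vanishes on the common kernel of the lower ones, it is a
    -- combination of them with coefficients `c j`. The monic `p = X^(k+1) - ∑ c j X^j` is then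
    -- orthogonal to all polynomials, itself included.
    have hs : m (k + 1) ∈ Submodule.span ℝ (Set.range fun j : Fin (k + 1) => m j) := by
      apply mem_span_of_iInf_ker_le_ker
      intro p hp
      simp only [Submodule.mem_iInf, LinearMap.mem_ker] at hp ⊢
      exact h p hp
    obtain ⟨c, hc⟩ := (Submodule.mem_span_range_iff_exists_fun ℝ).1 hs
    let p : ℝ[X] := X ^ (k + 1) - ∑ j : Fin (k + 1), C (c j) * X ^ (j : ℕ)
    have hp : p ≠ 0 := by
      intro hp
      have := congrArg (fun q : ℝ[X] => q.coeff (k + 1)) hp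
      simp only [p, coeff_sub, coeff_X_pow, finsetSum_coeff, coeff_C_mul, coeff_zero] at this
      rw [Finset.sum_eq_zero] at this
      · simp at this
      · intro j _
        simp [j.2.ne']
    have h0 : ∫ x in (0 : ℝ)..1, p.eval x * p.eval x = 0 := by
      have := LinearMap.congr_fun hc p
      simp only [LinearMap.sum_apply, LinearMap.smul_apply, smul_eq_mul] at this
      have h2 : ∫ x in (0 : ℝ)..1, p.eval x * p.eval x =
          m (k + 1) p - ∑ j : Fin (k + 1), c j * m j p := by
        simp only [m, LinearMap.coe_mk, AddHom.coe_mk, ← intervalIntegral.integral_const_mul]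
        rw [← intervalIntegral.integral_finsetSum, ← intervalIntegral.integral_sub]
        · congr 1
          ext x
          conv_lhs => enter [1]; simp only [p]
          simp [eval_finsetSum, sub_mul, Finset.sum_mul, mul_assoc]
        · exact Continuous.intervalIntegrable (by fun_prop) _ _
        · exact Continuous.intervalIntegrable (by fun_prop) _ _
        · exact fun _ _ => Continuous.intervalIntegrable (by fun_prop) _ _
      rw [h2, this, sub_self]
    have h1 : ∀ x ∈ Set.Icc (0 : ℝ) 1, p.eval x = 0 := by
      intro x hx
      by_contra hne
      have := intervalIntegral.integral_pos (f := fun x => p.eval x * p.eval x) zero_lt_one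
        (by fun_prop) (fun y _ => mul_self_nonneg _) ⟨x, hx, mul_self_pos.2 hne⟩
      exact this.ne' h0
    exact hp (eq_zero_of_infinite_isRoot p
      ((Set.Icc_infinite zero_lt_one).mono fun x hx => h1 x hx))

/-- `w` is a positive weight on `[0, 1]`, and `N` is a common denominator of its moments
of order at most `k`. -/
def HasDenominator (w : ℝ → ℝ) (N k : ℕ) : Prop :=
  Continuous w ∧ (∀ x ∈ Set.Icc (0 : ℝ) 1, 0 < w x) ∧
    ∀ j ≤ k, ∃ c : ℤ, N * ∫ x in (0 : ℝ)..1, x ^ j * w x = c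

/-- Take `w' = w + t e` with `e` from `exists_continuous_moments`: only the moment of order `k + 1`
is adjusted among those of order at most `k + 1`, and it changes by exactly `t`. -/
theorem HasDenominator.exists_succ {n : ℕ → ℕ} (hpos : ∀ i, 0 < n i) (hdvd : ∀ i, n i ∣ n (i + 1))
    (hunb : ∀ M, ∃ i, M < n i) {w : ℝ → ℝ} {i k : ℕ} (hw : HasDenominator w (n i) k) :
    ∃ (i' : ℕ) (w' : ℝ → ℝ), i ≤ i' ∧ HasDenominator w' (n i') (k + 1) ∧
      ∀ j ≤ k, ∫ x in (0 : ℝ)..1, x ^ j * w' x = ∫ x in (0 : ℝ)..1, x ^ j * w x := by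
  obtain ⟨hwc, hwpos, hwint⟩ := hw
  obtain ⟨e, hec, he0, he1⟩ := exists_continuous_moments k
  obtain ⟨x₀, hx₀, hmin⟩ := isCompact_Icc.exists_isMinOn (Set.nonempty_Icc.2 zero_le_one)
    (hwc.continuousOn (s := Set.Icc (0 : ℝ) 1))
  obtain ⟨B, hB⟩ := isCompact_Icc.exists_bound_of_continuousOn
    (hec.continuousOn (s := Set.Icc (0 : ℝ) 1))
  have hmono : ∀ a b, a ≤ b → n a ∣ n b := fun a b h => by
    induction h with
    | refl => exact dvd_rfl
    | step _ ih => exact ih.trans (hdvd _)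
  -- Rounding up costs `t ≤ 1 / n i'`, and `B` bounds `|e|`; hence `n i' > B / min w` keeps `w + t
  -- e` positive.
  obtain ⟨M, hM⟩ := exists_nat_gt (B / w x₀)
  obtain ⟨i₁, hi₁⟩ := hunb M
  let i' := max i i₁
  have hN : (0 : ℝ) < n i' := by exact_mod_cast hpos i'
  have hMN : (M : ℝ) < n i' := by
    exact_mod_cast hi₁.trans_le (Nat.le_of_dvd (hpos _) (hmono _ _ (le_max_right _ _)))
  let a : ℝ := n i' * ∫ x in (0 : ℝ)..1, x ^ (k + 1) * w x
  let t : ℝ := (⌈a⌉ - a) / n i'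
  have ht0 : 0 ≤ t := div_nonneg (sub_nonneg.2 (Int.le_ceil a)) hN.le
  have ht1 : t * n i' ≤ 1 := by
    simp only [t]
    rw [div_mul_cancel₀ _ hN.ne']
    linarith [Int.ceil_lt_add_one a]
  have hmom (j : ℕ) : ∫ x in (0 : ℝ)..1, x ^ j * (w x + t * e x) =
      (∫ x in (0 : ℝ)..1, x ^ j * w x) + t * ∫ x in (0 : ℝ)..1, x ^ j * e x := by
    rw [← intervalIntegral.integral_const_mul, ← intervalIntegral.integral_add]
    · congr 1; ext x; ring
    · exact Continuous.intervalIntegrable (by fun_prop) _ _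
    · exact Continuous.intervalIntegrable (by fun_prop) _ _
  refine ⟨i', fun x => w x + t * e x, le_max_left _ _, ⟨by fun_prop, fun x hx => ?_, fun j hj => ?_⟩,
    fun j hj => by rw [hmom, he0 j hj, mul_zero, add_zero]⟩
  · have h1 : w x₀ ≤ w x := hmin hx
    have h2 := neg_le_of_abs_le (hB x hx)
    have h3 : B < n i' * w x₀ := (div_lt_iff₀ (hwpos _ hx₀)).1 (hM.trans hMN)
    have h4 : t * B < w x₀ := by
      rcases ht0.eq_or_lt with h | h
      · rw [← h, zero_mul]; exact hwpos _ hx₀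
      · calc t * B < t * (n i' * w x₀) := mul_lt_mul_of_pos_left h3 h
          _ = t * n i' * w x₀ := by ring
          _ ≤ 1 * w x₀ := mul_le_mul_of_nonneg_right ht1 (hwpos _ hx₀).le
          _ = w x₀ := one_mul _
    have h5 : t * -B ≤ t * e x := mul_le_mul_of_nonneg_left h2 ht0
    linarith
  · rcases Nat.le_succ_iff.1 hj with h | rfl
    · obtain ⟨c, hc⟩ := hwint j h
      obtain ⟨d, hd⟩ := hmono i i' (le_max_left _ _)
      refine ⟨d * c, ?_⟩
      rw [hmom, he0 j h, mul_zero, add_zero, hd]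
      push_cast
      rw [← hc]
      ring
    · refine ⟨⌈a⌉, ?_⟩
      rw [hmom, he1, mul_add]
      change a + _ = _
      simp only [t]
      field_simp
      ring

/-- The integral of a Bernstein monomial against a weight. -/
noncomputable def bernsteinMoment (w : ℝ → ℝ) (j r : ℕ) : ℝ :=
  ∫ x in (0 : ℝ)..1, x ^ j * (1 - x) ^ r * w x

theorem bernsteinMoment_zero_right (w : ℝ → ℝ) (j : ℕ) :
    bernsteinMoment w j 0 = ∫ x in (0 : ℝ)..1, x ^ j * w x := by
  simp [bernsteinMoment]

/-- This is `(1 - x) + x = 1`, and it mirrors the branching rule for exterior powers. -/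
theorem bernsteinMoment_add {w : ℝ → ℝ} (hw : Continuous w) (j r : ℕ) :
    bernsteinMoment w j (r + 1) + bernsteinMoment w (j + 1) r = bernsteinMoment w j r := by
  unfold bernsteinMoment
  rw [← intervalIntegral.integral_add]
  · congr 1; ext x; ring
  · exact Continuous.intervalIntegrable (by fun_prop) _ _
  · exact Continuous.intervalIntegrable (by fun_prop) _ _

/-- Expanding `(1 - x)^r` involves only moments of order at most `j + r`, with integer coefficients.
The integrality in `HasDenominator.exists_int` has the same source. -/
theorem bernsteinMoment_congr {w w' : ℝ → ℝ} (hw : Continuous w) (hw' : Continuous w') {k : ℕ}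
    (h : ∀ j ≤ k, ∫ x in (0 : ℝ)..1, x ^ j * w' x = ∫ x in (0 : ℝ)..1, x ^ j * w x)
    (r j : ℕ) (hjr : j + r ≤ k) : bernsteinMoment w' j r = bernsteinMoment w j r := by
  induction r generalizing j with
  | zero => simpa only [bernsteinMoment_zero_right] using h j hjr
  | succ r ih =>
    have h1 := bernsteinMoment_add hw j r
    have h2 := bernsteinMoment_add hw' j r
    have h3 := ih j (by omega)
    have h4 := ih (j + 1) (by omega)
    linarith

theorem HasDenominator.exists_int {w : ℝ → ℝ} {N k : ℕ} (hw : HasDenominator w N k)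
    (r j : ℕ) (hjr : j + r ≤ k) : ∃ c : ℤ, N * bernsteinMoment w j r = c := by
  induction r generalizing j with
  | zero => simpa only [bernsteinMoment_zero_right] using hw.2.2 j hjr
  | succ r ih =>
    obtain ⟨c, hc⟩ := ih j (by omega)
    obtain ⟨d, hd⟩ := ih (j + 1) (by omega)
    refine ⟨c - d, ?_⟩
    push_cast
    rw [← hc, ← hd, ← bernsteinMoment_add hw.1 j r]
    ring

theorem HasDenominator.exists_nat {w : ℝ → ℝ} {N k : ℕ} (hw : HasDenominator w N k) (hN : 0 < N)
    (r j : ℕ) (hjr : j + r ≤ k) : ∃ c : ℕ, 0 < c ∧ N * bernsteinMoment w j r = c := by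
  obtain ⟨c, hc⟩ := hw.exists_int r j hjr
  have hpos : 0 < bernsteinMoment w j r := by
    have hwc := hw.1
    refine intervalIntegral.integral_pos zero_lt_one (by fun_prop) (fun x hx => ?_)
      ⟨1 / 2, by norm_num, ?_⟩
    · have := hw.2.1 x ⟨hx.1.le, hx.2⟩
      have h1 : 0 ≤ 1 - x := sub_nonneg.2 hx.2
      have h0 := hx.1
      positivity
    · have := hw.2.1 (1 / 2) (by norm_num)
      have h1 : (0 : ℝ) < 1 - 1 / 2 := by norm_num
      positivity
  have hc0 : 0 < c := by
    have : (0 : ℝ) < c := hc ▸ mul_pos (by exact_mod_cast hN) hpos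
    exact_mod_cast this
  lift c to ℕ using hc0.le
  exact ⟨c, by exact_mod_cast hc0, by exact_mod_cast hc⟩

/-- The multiplicities `a k j` of the `j`-th exterior powers in a compatible sequence of
`sl(k)`-modules of dimensions `n (i k)`. -/
theorem exists_multiplicities {n : ℕ → ℕ} (hpos : ∀ i, 0 < n i) (hdvd : ∀ i, n i ∣ n (i + 1))
    (hunb : ∀ M, ∃ i, M < n i) :
    ∃ (i : ℕ → ℕ) (a : ℕ → ℕ → ℕ), (∀ k, i k ≤ i (k + 1)) ∧ a 0 0 = n (i 0) ∧
      (∀ k, ∀ j ≤ k, 0 < a k j) ∧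
      ∀ k, ∀ j ≤ k, n (i k) * (a (k + 1) j + a (k + 1) (j + 1)) = n (i (k + 1)) * a k j := by
  choose! I W hI hW hWm using fun (k : ℕ) (i : ℕ) (w : ℝ → ℝ) (h : HasDenominator w (n i) k) =>
    h.exists_succ hpos hdvd hunb
  let st : ℕ → ℕ × (ℝ → ℝ) := fun k =>
    Nat.rec (0, fun _ => 1) (fun k p => (I k p.1 p.2, W k p.1 p.2)) k
  have hst : ∀ k, HasDenominator (st k).2 (n (st k).1) k := by
    intro k
    induction k with
    | zero =>
      refine ⟨continuous_const, fun _ _ => one_pos, fun j hj => ⟨n 0, ?_⟩⟩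
      obtain rfl := Nat.le_zero.1 hj
      simp [st]
    | succ k ih => exact hW k _ _ ih
  -- The multiplicity is `n (i k) ∫ x^j (1-x)^(k-j) w_k`; nothing is asked of it for `j > k`.
  have hex : ∀ k j, ∃ c : ℕ, j ≤ k →
      0 < c ∧ n (st k).1 * bernsteinMoment (st k).2 j (k - j) = c := by
    intro k j
    by_cases hj : j ≤ k
    · obtain ⟨c, hc⟩ := (hst k).exists_nat (hpos _) (k - j) j (by omega)
      exact ⟨c, fun _ => hc⟩
    · exact ⟨0, fun h => absurd h hj⟩
  choose a ha using hex
  refine ⟨fun k => (st k).1, a, fun k => hI k _ _ (hst k), ?_, fun k j hj => (ha k j hj).1,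
    fun k j hj => ?_⟩
  · have := (ha 0 0 le_rfl).2
    have h1 : bernsteinMoment (st 0).2 0 (0 - 0) = 1 := by simp [st, bernsteinMoment]
    rw [h1, mul_one] at this
    exact_mod_cast this.symm
  · have h1 := (ha k j hj).2
    have h2 := (ha (k + 1) j (by omega)).2
    have h3 := (ha (k + 1) (j + 1) (by omega)).2
    have h4 := bernsteinMoment_add (hst (k + 1)).1 j (k - j)
    -- The weight changes with `k`, but its moments of order at most `k` do not, so the recursion
    -- links the two stages.
    have h5 : bernsteinMoment (st (k + 1)).2 j (k - j) = bernsteinMoment (st k).2 j (k - j) :=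
      bernsteinMoment_congr (hst k).1 (hst (k + 1)).1 (hWm k _ _ (hst k)) _ _ (by omega)
    rw [show k + 1 - j = k - j + 1 by omega] at h2
    rw [show k + 1 - (j + 1) = k - j by omega] at h3
    have : (n (st k).1 : ℝ) * (a (k + 1) j + a (k + 1) (j + 1)) = n (st (k + 1)).1 * a k j := by
      rw [← h1, ← h2, ← h3, ← mul_add, h4, h5]
      ring
    exact_mod_cast this

end Moments

/-! ### The fermionic Fock space -/

/-- The standard basis of the exterior algebra of `ℂ ^ k`: subsets of a set with `k` elements. -/
def Fock : ℕ → Type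
  | 0 => Unit
  | k + 1 => Fock k ⊕ Fock k

namespace Fock

instance instFintype : ∀ k, Fintype (Fock k)
  | 0 => inferInstanceAs (Fintype Unit)
  | k + 1 => by
    haveI := instFintype k
    exact inferInstanceAs (Fintype (Fock k ⊕ Fock k))

instance instDecidableEq : ∀ k, DecidableEq (Fock k)
  | 0 => inferInstanceAs (DecidableEq Unit)
  | k + 1 => by
    haveI := instDecidableEq k
    exact inferInstanceAs (DecidableEq (Fock k ⊕ Fock k))

instance instNonempty : ∀ k, Nonempty (Fock k)
  | 0 => ⟨()⟩
  | k + 1 => (instNonempty k).map Sum.inl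

/-- The number of elements of a subset. -/
def deg : ∀ {k : ℕ}, Fock k → ℕ
  | 0, _ => 0
  | _ + 1, Sum.inl S => deg S
  | _ + 1, Sum.inr S => deg S + 1

theorem deg_le : ∀ {k : ℕ} (S : Fock k), deg S ≤ k
  | 0, _ => le_rfl
  | _ + 1, Sum.inl S => (deg_le S).trans (Nat.le_succ _)
  | _ + 1, Sum.inr S => Nat.succ_le_succ (deg_le S)

/-- Operators on the exterior algebra of `ℂ ^ (k + 1)`, written as `2 × 2` block matrices. -/
def blocks {k : ℕ} (A B C D : Matrix (Fock k) (Fock k) ℂ) :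
    Matrix (Fock (k + 1)) (Fock (k + 1)) ℂ :=
  Matrix.fromBlocks A B C D

theorem blocks_mul {k : ℕ} (A B C D A' B' C' D' : Matrix (Fock k) (Fock k) ℂ) :
    blocks A B C D * blocks A' B' C' D' =
      blocks (A * A' + B * C') (A * B' + B * D') (C * A' + D * C') (C * B' + D * D') :=
  Matrix.fromBlocks_multiply ..

theorem blocks_add {k : ℕ} (A B C D A' B' C' D' : Matrix (Fock k) (Fock k) ℂ) :
    blocks A B C D + blocks A' B' C' D' = blocks (A + A') (B + B') (C + C') (D + D') :=
  Matrix.fromBlocks_add ..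

theorem blocks_one (k : ℕ) : (1 : Matrix (Fock (k + 1)) (Fock (k + 1)) ℂ) = blocks 1 0 0 1 :=
  Matrix.fromBlocks_one.symm

theorem blocks_zero (k : ℕ) : (0 : Matrix (Fock (k + 1)) (Fock (k + 1)) ℂ) = blocks 0 0 0 0 :=
  Matrix.fromBlocks_zero.symm

theorem smul_blocks {k : ℕ} (c : ℂ) (A B C D : Matrix (Fock k) (Fock k) ℂ) :
    c • blocks A B C D = blocks (c • A) (c • B) (c • C) (c • D) :=
  Matrix.fromBlocks_smul ..

theorem sum_blocks {k : ℕ} {ι : Type*} (s : Finset ι) (A : ι → Matrix (Fock k) (Fock k) ℂ) :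
    ∑ i ∈ s, blocks (A i) 0 0 (A i) = blocks (∑ i ∈ s, A i) 0 0 (∑ i ∈ s, A i) := by
  classical
  induction s using Finset.induction_on with
  | empty => simp [blocks_zero]
  | insert i s hi ih => simp [Finset.sum_insert hi, ih, blocks_add]

/-- The annihilation operators. -/
def ann : ∀ k : ℕ, Fin k → Matrix (Fock k) (Fock k) ℂ
  | 0 => Fin.elim0
  | k + 1 => Fin.snoc (α := fun _ => Matrix (Fock (k + 1)) (Fock (k + 1)) ℂ)
      -- The sign on the second block makes the old operators anticommute with the new one.
      (fun p => blocks (ann k p) 0 0 (-ann k p)) (blocks 0 1 0 0)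

/-- The creation operators. -/
def cre : ∀ k : ℕ, Fin k → Matrix (Fock k) (Fock k) ℂ
  | 0 => Fin.elim0
  | k + 1 => Fin.snoc (α := fun _ => Matrix (Fock (k + 1)) (Fock (k + 1)) ℂ)
      (fun p => blocks (cre k p) 0 0 (-cre k p)) (blocks 0 0 1 0)

@[simp] theorem ann_castSucc (k : ℕ) (p : Fin k) :
    ann (k + 1) p.castSucc = blocks (ann k p) 0 0 (-ann k p) := by simp [ann]

@[simp] theorem ann_last (k : ℕ) : ann (k + 1) (Fin.last k) = blocks 0 1 0 0 := by simp [ann]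

@[simp] theorem cre_castSucc (k : ℕ) (p : Fin k) :
    cre (k + 1) p.castSucc = blocks (cre k p) 0 0 (-cre k p) := by simp [cre]

@[simp] theorem cre_last (k : ℕ) : cre (k + 1) (Fin.last k) = blocks 0 0 1 0 := by simp [cre]

theorem ann_anticomm (k : ℕ) (p q : Fin k) : ann k p * ann k q + ann k q * ann k p = 0 := by
  induction k with
  | zero => exact p.elim0
  | succ k ih =>
    induction p using Fin.lastCases <;> induction q using Fin.lastCases <;>
      simp [blocks_mul, blocks_add, blocks_zero, ih]

theorem cre_anticomm (k : ℕ) (p q : Fin k) : cre k p * cre k q + cre k q * cre k p = 0 := by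
  induction k with
  | zero => exact p.elim0
  | succ k ih =>
    induction p using Fin.lastCases <;> induction q using Fin.lastCases <;>
      simp [blocks_mul, blocks_add, blocks_zero, ih]

theorem ann_cre (k : ℕ) (p q : Fin k) :
    ann k p * cre k q + cre k q * ann k p = if p = q then 1 else 0 := by
  induction k with
  | zero => exact p.elim0
  | succ k ih =>
    induction p using Fin.lastCases <;> induction q using Fin.lastCases <;>
      simp [blocks_mul, blocks_add, blocks_zero, blocks_one, ih, Fin.castSucc_ne_last,
        (Fin.castSucc_ne_last _).symm]
    split_ifs <;> rfl

theorem deg_of_ann_ne_zero {k : ℕ} {p : Fin k} {S S' : Fock k} (h : ann k p S S' ≠ 0) :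
    deg S' = deg S + 1 := by
  induction k with
  | zero => exact p.elim0
  | succ k ih =>
    induction p using Fin.lastCases with
    | last =>
      rcases S with S | S <;> rcases S' with S' | S' <;>
        simp [blocks, Matrix.one_apply] at h
      simp [deg, h]
    | cast p =>
      rcases S with S | S <;> rcases S' with S' | S' <;> simp [blocks] at h <;>
        simp [deg, ih h]

theorem deg_of_cre_ne_zero {k : ℕ} {p : Fin k} {S S' : Fock k} (h : cre k p S S' ≠ 0) :
    deg S = deg S' + 1 := by
  induction k with
  | zero => exact p.elim0
  | succ k ih =>
    induction p using Fin.lastCases with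
    | last =>
      rcases S with S | S <;> rcases S' with S' | S' <;>
        simp [blocks, Matrix.one_apply] at h
      simp [deg, h]
    | cast p =>
      rcases S with S | S <;> rcases S' with S' | S' <;> simp [blocks] at h <;>
        simp [deg, ih h]

/-- The action of `gl(k)` on the exterior algebra of `ℂ ^ k`. -/
noncomputable def spin (k : ℕ) : Matrix (Fin k) (Fin k) ℂ →ₗ[ℂ] Matrix (Fock k) (Fock k) ℂ where
  toFun x := ∑ p, ∑ q, x p q • (cre k p * ann k q)
  map_add' x y := by simp [add_smul, Finset.sum_add_distrib]
  map_smul' c x := by simp [mul_smul, Finset.smul_sum]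

theorem spin_apply (k : ℕ) (x : Matrix (Fin k) (Fin k) ℂ) :
    spin k x = ∑ p, ∑ q, x p q • (cre k p * ann k q) := rfl

/-- Under commutators with `spin k x`, creation operators span the natural module; annihilation
operators span its dual in `spin_mul_ann_sub`. -/
theorem spin_mul_cre_sub (k : ℕ) (x : Matrix (Fin k) (Fin k) ℂ) (r : Fin k) :
    spin k x * cre k r - cre k r * spin k x = ∑ p, x p r • cre k p := by
  have key (p q : Fin k) : cre k p * ann k q * cre k r - cre k r * (cre k p * ann k q) =
      if q = r then cre k p else 0 := by
    have h1 := cre_anticomm k p r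
    have h2 := ann_cre k q r
    calc _ = cre k p * (ann k q * cre k r + cre k r * ann k q) -
          (cre k p * cre k r + cre k r * cre k p) * ann k q := by noncomm_ring
      _ = _ := by rw [h1, h2]; split_ifs <;> simp
  simp only [spin_apply, Finset.sum_mul, Finset.mul_sum, ← Finset.sum_sub_distrib, smul_mul_assoc,
    mul_smul_comm, ← smul_sub, key]
  simp

theorem spin_mul_ann_sub (k : ℕ) (x : Matrix (Fin k) (Fin k) ℂ) (r : Fin k) :
    spin k x * ann k r - ann k r * spin k x = -∑ q, x r q • ann k q := by
  have key (p q : Fin k) : cre k p * ann k q * ann k r - ann k r * (cre k p * ann k q) =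
      if r = p then -ann k q else 0 := by
    have h1 := ann_anticomm k q r
    have h2 := ann_cre k r p
    calc _ = cre k p * (ann k q * ann k r + ann k r * ann k q) -
          (ann k r * cre k p + cre k p * ann k r) * ann k q := by noncomm_ring
      _ = _ := by rw [h1, h2]; split_ifs <;> simp
  simp only [spin_apply, Finset.sum_mul, Finset.mul_sum, ← Finset.sum_sub_distrib, smul_mul_assoc,
    mul_smul_comm, ← smul_sub, key]
  rw [Finset.sum_comm]
  simp

/-- Commutation with `spin k x` is a derivation, so its value on each `cre k p * ann k q` follows
from its values on the two factors. -/
theorem spin_commutator (k : ℕ) (x y : Matrix (Fin k) (Fin k) ℂ) :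
    spin k (x * y - y * x) = spin k x * spin k y - spin k y * spin k x := by
  have key (p q : Fin k) :
      spin k x * (cre k p * ann k q) - (cre k p * ann k q) * spin k x =
        (∑ r, x r p • cre k r) * ann k q - cre k p * ∑ r, x q r • ann k r := by
    have h1 := spin_mul_cre_sub k x p
    have h2 := spin_mul_ann_sub k x q
    calc _ = (spin k x * cre k p - cre k p * spin k x) * ann k q +
          cre k p * (spin k x * ann k q - ann k q * spin k x) := by noncomm_ring
      _ = _ := by rw [h1, h2]; noncomm_ring
  conv_rhs => rw [spin_apply k y]
  simp only [Finset.sum_mul, Finset.mul_sum, ← Finset.sum_sub_distrib, smul_mul_assoc,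
    mul_smul_comm, ← smul_sub, key]
  simp only [map_sub, spin_apply, Matrix.mul_apply, Finset.sum_smul, Finset.sum_sub_distrib,
    smul_sub, Finset.smul_sum, smul_smul]
  congr 1
  · have h3 (F : Fin k → Fin k → Fin k → Matrix (Fock k) (Fock k) ℂ) :
        ∑ p, ∑ q, ∑ r, F p q r = ∑ r, ∑ q, ∑ p, F p q r := by
      rw [Finset.sum_comm, Finset.sum_congr rfl fun _ _ => Finset.sum_comm, Finset.sum_comm]
    rw [h3]
    simp only [mul_comm]
  · exact Finset.sum_congr rfl fun _ _ => Finset.sum_comm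

/-- The anticommutator of `ann k q` with `[spin k x, cre k r]` is the scalar `x q r`. -/
theorem spin_injective {k : ℕ} {x : Matrix (Fin k) (Fin k) ℂ} (h : spin k x = 0) : x = 0 := by
  ext q r
  have h1 := spin_mul_cre_sub k x r
  rw [h, zero_mul, mul_zero, sub_zero] at h1
  have h2 : ann k q * (∑ p, x p r • cre k p) + (∑ p, x p r • cre k p) * ann k q = 0 := by
    simp [← h1]
  simp only [Finset.sum_mul, Finset.mul_sum, ← Finset.sum_add_distrib, smul_mul_assoc,
    mul_smul_comm, ← smul_add, ann_cre] at h2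
  simpa using h2

theorem deg_eq_of_spin_ne_zero {k : ℕ} {x : Matrix (Fin k) (Fin k) ℂ} {S S' : Fock k}
    (h : spin k x S S' ≠ 0) : deg S = deg S' := by
  simp only [spin_apply, Matrix.sum_apply, Matrix.smul_apply, Matrix.mul_apply] at h
  obtain ⟨p, -, h⟩ := Finset.exists_ne_zero_of_sum_ne_zero h
  obtain ⟨q, -, h⟩ := Finset.exists_ne_zero_of_sum_ne_zero h
  obtain ⟨R, -, h⟩ := Finset.exists_ne_zero_of_sum_ne_zero (right_ne_zero_of_smul h)
  rw [deg_of_cre_ne_zero (left_ne_zero_of_mul h), deg_of_ann_ne_zero (right_ne_zero_of_mul h)]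

/-- Only quadratic terms in the old operators survive, and in these the two signs of the second
block cancel. -/
theorem spin_slCorner (k : ℕ) (x : sl (Fin k) ℂ) :
    spin (k + 1) (slCorner k x).1 = blocks (spin k x.1) 0 0 (spin k x.1) := by
  have e1 (p q : Fin k) : (slCorner k x).1 p.castSucc q.castSucc = x.1 p q := by
    have h (p : Fin k) : finSumFinEquiv.symm p.castSucc = (Sum.inl p : Fin k ⊕ Fin 1) :=
      finSumFinEquiv_symm_apply_castAdd p
    simp [slCorner, h]
  have e2 (p : Fin (k + 1)) : (slCorner k x).1 p (Fin.last k) = 0 := by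
    induction p using Fin.lastCases <;> simp [slCorner]
  have e3 (p : Fin (k + 1)) : (slCorner k x).1 (Fin.last k) p = 0 := by
    induction p using Fin.lastCases <;> simp [slCorner]
  simp [spin_apply, Fin.sum_univ_castSucc, e1, e2, e3, blocks_mul, smul_blocks, sum_blocks]

end Fock

/-! ### Sums of exterior powers with multiplicities -/

theorem LinearMap.apply_eq_zero_of_trace_eq_zero {k : ℕ} (τ : Matrix (Fin k) (Fin k) ℂ →ₗ[ℂ] ℂ)
    (hτ : ∀ x y, τ (x * y) = τ (y * x)) {x : Matrix (Fin k) (Fin k) ℂ} (hx : x.trace = 0) :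
    τ x = 0 := by
  have h1 (p q : Fin k) (h : p ≠ q) : τ (Matrix.single p q 1) = 0 := by
    have := hτ (Matrix.single p p 1) (Matrix.single p q 1)
    simpa [Matrix.single_mul_single_of_ne, h.symm] using this
  have h2 (p q : Fin k) : τ (Matrix.single p p 1) = τ (Matrix.single q q 1) := by
    have := hτ (Matrix.single p q 1) (Matrix.single q p 1)
    simpa using this
  rcases k.eq_zero_or_pos with rfl | hk
  · rw [Subsingleton.elim x 0, map_zero]
  · have h3 (p q : Fin k) : τ (Matrix.single p q (x p q)) =
        if p = q then x p p * τ (Matrix.single ⟨0, hk⟩ ⟨0, hk⟩ 1) else 0 := by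
      have : Matrix.single p q (x p q) = x p q • Matrix.single p q (1 : ℂ) := by simp
      rw [this, map_smul, smul_eq_mul]
      split_ifs with h
      · subst h; rw [h2 p]
      · rw [h1 p q h, mul_zero]
    conv_lhs => rw [Matrix.matrix_eq_sum_single x]
    simp only [map_sum, h3]
    simp only [Finset.sum_ite_eq, Finset.mem_univ, if_true, ← Finset.sum_mul]
    exact mul_eq_zero_of_left hx _

namespace Fock

/-- A matrix is graded if it preserves the degree. -/
def IsGraded {k : ℕ} (X : Matrix (Fock k) (Fock k) ℂ) : Prop :=
  ∀ S S', X S S' ≠ 0 → deg S = deg S'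

theorem isGraded_spin {k : ℕ} (x : Matrix (Fin k) (Fin k) ℂ) : IsGraded (spin k x) :=
  fun _ _ => deg_eq_of_spin_ne_zero

/-- The standard basis of the sum over `j` of `a j` copies of the `j`-th exterior power. -/
abbrev Amp (k : ℕ) (a : ℕ → ℕ) : Type := Σ S : Fock k, Fin (a (deg S))

/-- The action of a graded matrix on the sum over `j` of `a j` copies of the part of degree `j`. -/
def amp {k : ℕ} (a : ℕ → ℕ) :
    Matrix (Fock k) (Fock k) ℂ →ₗ[ℂ] Matrix (Amp k a) (Amp k a) ℂ where
  toFun X := Matrix.of fun p q => if p.2.val = q.2.val then X p.1 q.1 else 0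
  map_add' X Y := by ext p q; simp [ite_add_ite]
  map_smul' c X := by ext p q; simp

theorem amp_apply {k : ℕ} (a : ℕ → ℕ) (X : Matrix (Fock k) (Fock k) ℂ) (p q : Amp k a) :
    amp a X p q = if p.2.val = q.2.val then X p.1 q.1 else 0 := rfl

/-- Nonzero entries of `X` join subsets of equal degree, hence with equally many copies, so the
intermediate copy index exists and is unique. -/
theorem amp_mul {k : ℕ} (a : ℕ → ℕ) {X : Matrix (Fock k) (Fock k) ℂ} (hX : IsGraded X)
    (Y : Matrix (Fock k) (Fock k) ℂ) : amp a (X * Y) = amp a X * amp a Y := by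
  ext ⟨S, i⟩ ⟨S'', i''⟩
  simp only [amp_apply, Matrix.mul_apply, Fintype.sum_sigma]
  have key (S' : Fock k) : ∑ i' : Fin (a (deg S')),
      ((if (i : ℕ) = i' then X S S' else 0) * if (i' : ℕ) = i'' then Y S' S'' else 0) =
        if (i : ℕ) = i'' then X S S' * Y S' S'' else 0 := by
    by_cases h : X S S' = 0
    · simp [h]
    · have hd := hX S S' h
      rw [Finset.sum_eq_single (Fin.cast (by rw [hd]) i)]
      · simp
      · intro i' _ hi'
        rw [if_neg fun h => hi' (Fin.ext h.symm), zero_mul]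
      · simp
  simp only [key]
  split_ifs <;> simp

theorem eq_zero_of_amp_eq_zero {k : ℕ} {a : ℕ → ℕ} (ha : ∀ j ≤ k, 0 < a j)
    {X : Matrix (Fock k) (Fock k) ℂ} (h : amp a X = 0) : X = 0 := by
  ext S S'
  exact congrFun₂ h ⟨S, ⟨0, ha _ (deg_le S)⟩⟩ ⟨S', ⟨0, ha _ (deg_le S')⟩⟩

theorem amp_spin_commutator {k : ℕ} (a : ℕ → ℕ) (x y : Matrix (Fin k) (Fin k) ℂ) :
    amp a (spin k (x * y - y * x)) =
      amp a (spin k x) * amp a (spin k y) - amp a (spin k y) * amp a (spin k x) := by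
  rw [spin_commutator, map_sub, amp_mul a (isGraded_spin x), amp_mul a (isGraded_spin y)]

/-- The trace of a representation kills commutators, hence is proportional to the trace on `gl(k)`.
-/
theorem trace_amp_spin {k : ℕ} (a : ℕ → ℕ) (x : sl (Fin k) ℂ) :
    (amp a (spin k x.1)).trace = 0 := by
  refine LinearMap.apply_eq_zero_of_trace_eq_zero
    (Matrix.traceLinearMap (Amp k a) ℂ ℂ ∘ₗ amp a ∘ₗ spin k) (fun y z => ?_) x.2
  rw [← sub_eq_zero, ← map_sub]
  simp only [LinearMap.comp_apply, Matrix.traceLinearMap_apply, amp_spin_commutator,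
    Matrix.trace_sub]
  rw [Matrix.trace_mul_comm, sub_self]

/-- A bijection of the standard bases of `s` copies of the exterior powers of `ℂ ^ k` and of
the exterior powers of `ℂ ^ (k + 1)` that is compatible with the operators of `sl(k)`. -/
theorem exists_branching {k s : ℕ} {a b : ℕ → ℕ} (h : ∀ j ≤ k, b j + b (j + 1) = s * a j) :
    ∃ π : Fin s × Amp k a ≃ Amp (k + 1) b, ∀ Y : Matrix (Fock k) (Fock k) ℂ, IsGraded Y →
      ∀ p q, amp b (blocks Y 0 0 Y) (π p) (π q) = if p.1 = q.1 then amp a Y p.2 q.2 else 0 := by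
  -- A subset of degree `j` extends to `Fock (k + 1)` with degree `j` or `j + 1`. The matching of
  -- copies depends on `j` alone, so degree-preserving operators respect it.
  have hθ (j : ℕ) (hj : j ≤ k) : Nonempty (Fin s × Fin (a j) ≃ Fin (b j) ⊕ Fin (b (j + 1))) :=
    ⟨Fintype.equivOfCardEq (by simp [h j hj])⟩
  let θ (j : ℕ) (hj : j ≤ k) := (hθ j hj).some
  -- Copy indices over different subsets lie in different types, so they are compared through their
  -- values.
  have key (j j' : ℕ) (hj : j ≤ k) (hj' : j' ≤ k) (e : j = j') (i : Fin s × Fin (a j))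
      (i' : Fin s × Fin (a j')) :
      Sum.map Fin.val Fin.val (θ j hj i) = Sum.map Fin.val Fin.val (θ j' hj' i') ↔
        i.1 = i'.1 ∧ i.2.val = i'.2.val := by
    subst e
    rw [(Sum.map_injective.2 ⟨Fin.val_injective, Fin.val_injective⟩).eq_iff,
      EmbeddingLike.apply_eq_iff_eq, Prod.ext_iff, Fin.val_inj]
  let g (S : Fock k) : Fin (b (deg S)) ⊕ Fin (b (deg S + 1)) → Amp (k + 1) b :=
    Sum.elim (fun i => ⟨Sum.inl S, i⟩) (fun i => ⟨Sum.inr S, i⟩)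
  let g' : Amp (k + 1) b → Fin s × Amp k a := fun q => match q with
    | ⟨Sum.inl S, i⟩ => (fun u => (u.1, ⟨S, u.2⟩)) ((θ _ (deg_le S)).symm (Sum.inl i))
    | ⟨Sum.inr S, i⟩ => (fun u => (u.1, ⟨S, u.2⟩)) ((θ _ (deg_le S)).symm (Sum.inr i))
  have hg (S : Fock k) (u : Fin (b (deg S)) ⊕ Fin (b (deg S + 1))) :
      g' (g S u) = (((θ _ (deg_le S)).symm u).1, ⟨S, ((θ _ (deg_le S)).symm u).2⟩) := by
    rcases u with u | u <;> rfl
  let π : Fin s × Amp k a ≃ Amp (k + 1) b :=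
    { toFun := fun p => g p.2.1 (θ _ (deg_le p.2.1) (p.1, p.2.2))
      invFun := g'
      left_inv := fun p => by rw [hg, Equiv.symm_apply_apply]
      right_inv := by
        rintro ⟨S | S, i⟩
        · exact congrArg (g S) ((θ _ (deg_le S)).apply_symm_apply (Sum.inl i))
        · exact congrArg (g S) ((θ _ (deg_le S)).apply_symm_apply (Sum.inr i)) }
  refine ⟨π, fun Y hY => ?_⟩
  rintro ⟨t, S, i⟩ ⟨t', S', i'⟩
  change amp b (blocks Y 0 0 Y) (g S (θ _ (deg_le S) (t, i))) (g S' (θ _ (deg_le S') (t', i'))) = _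
  have hc (u : Fin (b (deg S)) ⊕ Fin (b (deg S + 1)))
      (u' : Fin (b (deg S')) ⊕ Fin (b (deg S' + 1))) :
      amp b (blocks Y 0 0 Y) (g S u) (g S' u') =
        if Sum.map Fin.val Fin.val u = Sum.map Fin.val Fin.val u' then Y S S' else 0 := by
    rcases u with u | u <;> rcases u' with u' | u'
    · change (if u.val = u'.val then Y S S' else 0) = _
      simp
    · change (if u.val = u'.val then (0 : ℂ) else 0) = _
      simp
    · change (if u.val = u'.val then (0 : ℂ) else 0) = _
      simp
    · change (if u.val = u'.val then Y S S' else 0) = _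
      simp
  rw [hc]
  by_cases h0 : Y S S' = 0
  · simp [amp_apply, h0]
  · simp only [key _ _ _ _ (hY S S' h0), amp_apply, ite_and]

/-- The natural module of `sl(N)`, restricted along `ρ` to `sl(k)`, is isomorphic to the sum over
`j` of `a j` copies of the `j`-th exterior power. -/
def Models {k N : ℕ} (a : ℕ → ℕ) (ρ : sl (Fin k) ℂ →ₗ⁅ℂ⁆ sl (Fin N) ℂ) : Prop :=
  ∃ e : (Fin N → ℂ) ≃ₗ[ℂ] (Amp k a → ℂ), ∀ x v,
    e (Matrix.mulVec (ρ x).1 v) = Matrix.mulVec (amp a (spin k x.1)) (e v)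

theorem Models.injective {k N : ℕ} {a : ℕ → ℕ} {ρ : sl (Fin k) ℂ →ₗ⁅ℂ⁆ sl (Fin N) ℂ}
    (h : Models a ρ) (ha : ∀ j ≤ k, 0 < a j) : Function.Injective ρ := by
  obtain ⟨e, he⟩ := h
  rw [injective_iff_map_eq_zero]
  intro x hx
  refine Subtype.ext (spin_injective (eq_zero_of_amp_eq_zero ha (Matrix.ext_of_mulVec_single
    fun i => ?_)))
  have := he x (e.symm (Pi.single i 1))
  rw [hx, e.apply_symm_apply] at this
  rw [← this]
  simp only [ZeroMemClass.coe_zero, Matrix.zero_mulVec, map_zero]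

/-- Transport of the action of `sl(k)` on the sum of exterior powers. -/
theorem exists_lieHom_of_linearEquiv {k N : ℕ} {a : ℕ → ℕ}
    (e : (Fin N → ℂ) ≃ₗ[ℂ] (Amp k a → ℂ)) :
    ∃ ρ : sl (Fin k) ℂ →ₗ⁅ℂ⁆ sl (Fin N) ℂ, ∀ x v,
      e (Matrix.mulVec (ρ x).1 v) = Matrix.mulVec (amp a (spin k x.1)) (e v) := by
  obtain ⟨Φ, hΦ⟩ : ∃ Φ : Matrix (Amp k a) (Amp k a) ℂ ≃ₐ[ℂ] Matrix (Fin N) (Fin N) ℂ,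
      ∀ X v, e (Matrix.mulVec (Φ X) v) = Matrix.mulVec X (e v) := by
    refine ⟨(Matrix.toLinAlgEquiv'.trans (e.symm.conjAlgEquiv ℂ)).trans
      LinearMap.toMatrixAlgEquiv', fun X v => ?_⟩
    change e (Matrix.mulVec (LinearMap.toMatrix' (e.symm.conjAlgEquiv ℂ (Matrix.toLin' X))) v) = _
    rw [LinearMap.toMatrix'_mulVec]
    simp
  have htr (X : Matrix (Amp k a) (Amp k a) ℂ) : (Φ X).trace = X.trace := by
    have h : Matrix.toLin' (Φ X) = e.symm.conj (Matrix.toLin' X) :=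
      LinearMap.ext fun v => e.injective (by simp [hΦ, LinearEquiv.conj_apply])
    rw [← Matrix.trace_toLin'_eq X, ← LinearMap.trace_conj' _ e.symm, ← Matrix.trace_toLin'_eq, h]
  exact ⟨{ toFun := fun x => ⟨Φ (amp a (spin k x.1)), (htr _).trans (trace_amp_spin a x)⟩
           map_add' := fun x y => Subtype.ext (by simp)
           map_smul' := fun c x => Subtype.ext (by simp)
           map_lie' := fun {x y} => Subtype.ext (by
             change Φ (amp a (spin k (x.1 * y.1 - y.1 * x.1))) =
               Φ (amp a (spin k x.1)) * Φ (amp a (spin k y.1)) -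
                 Φ (amp a (spin k y.1)) * Φ (amp a (spin k x.1))
             rw [amp_spin_commutator, map_sub, map_mul, map_mul]) },
    fun x v => hΦ _ v⟩

theorem exists_models_zero (a : ℕ → ℕ) :
    ∃ ρ : sl (Fin 0) ℂ →ₗ⁅ℂ⁆ sl (Fin (a 0)) ℂ, Models a ρ := by
  let π : Amp 0 a ≃ Fin (a 0) :=
    { toFun := fun p => p.2
      invFun := fun i => ⟨(), i⟩
      left_inv := fun _ => rfl
      right_inv := fun _ => rfl }
  obtain ⟨ρ, hρ⟩ := exists_lieHom_of_linearEquiv (LinearEquiv.funCongrLeft ℂ ℂ π)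
  exact ⟨ρ, _, hρ⟩

end Fock

/-! ### Multiples of the natural module -/

/-- The natural module of `sl(m)`, restricted along `φ` to `sl(n)`, is isomorphic to the sum of `s`
copies of the natural module. -/
def IsMultiple {n m : ℕ} (s : ℕ) (φ : sl (Fin n) ℂ →ₗ⁅ℂ⁆ sl (Fin m) ℂ) : Prop :=
  ∃ e : (Fin m → ℂ) ≃ₗ[ℂ] (Fin s → Fin n → ℂ), ∀ x v t,
    e (Matrix.mulVec (φ x).1 v) t = Matrix.mulVec x.1 (e v t)

namespace IsMultiple

theorem eq_mul {n m s : ℕ} {φ : sl (Fin n) ℂ →ₗ⁅ℂ⁆ sl (Fin m) ℂ} (h : IsMultiple s φ) :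
    m = s * n := by
  obtain ⟨e, -⟩ := h
  simpa [Module.finrank_pi_fintype] using e.finrank_eq

theorem injective {n m s : ℕ} {φ : sl (Fin n) ℂ →ₗ⁅ℂ⁆ sl (Fin m) ℂ} (h : IsMultiple s φ)
    (hs : 0 < s) : Function.Injective φ := by
  obtain ⟨e, he⟩ := h
  rw [injective_iff_map_eq_zero]
  intro x hx
  refine Subtype.ext (Matrix.ext_of_mulVec_single fun i => ?_)
  have := he x (e.symm fun _ => Pi.single i 1) ⟨0, hs⟩
  rw [hx, e.apply_symm_apply] at this
  rw [← this]
  simp only [ZeroMemClass.coe_zero, Matrix.zero_mulVec, map_zero, Pi.zero_apply]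

theorem id (n : ℕ) : IsMultiple 1 (LieHom.id : sl (Fin n) ℂ →ₗ⁅ℂ⁆ sl (Fin n) ℂ) :=
  ⟨(LinearEquiv.funUnique (Fin 1) ℂ (Fin n → ℂ)).symm, fun _ _ _ => rfl⟩

theorem comp {n m l s t : ℕ} {ψ : sl (Fin m) ℂ →ₗ⁅ℂ⁆ sl (Fin l) ℂ}
    {φ : sl (Fin n) ℂ →ₗ⁅ℂ⁆ sl (Fin m) ℂ} (hψ : IsMultiple t ψ) (hφ : IsMultiple s φ) :
    IsMultiple (t * s) (ψ.comp φ) := by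
  obtain ⟨e, he⟩ := hψ
  obtain ⟨d, hd⟩ := hφ
  refine ⟨e ≪≫ₗ LinearEquiv.piCongrRight (fun _ => d) ≪≫ₗ
    (LinearEquiv.curry ℂ (Fin n → ℂ) (Fin t) (Fin s)).symm ≪≫ₗ
    LinearEquiv.funCongrLeft ℂ (Fin n → ℂ) finProdFinEquiv.symm, fun x v i => ?_⟩
  obtain ⟨⟨i, j⟩, rfl⟩ := finProdFinEquiv.surjective i
  have h1 := hd x (e v i) j
  have h2 := he (φ x) v i
  simp [-finProdFinEquiv_symm_apply, LinearMap.funLeft_apply] at h1 h2 ⊢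
  rw [h2, h1]

end IsMultiple

theorem HasSignature.isMultiple {n m s : ℕ} {φ : sl (Fin n) ℂ →ₗ⁅ℂ⁆ sl (Fin m) ℂ}
    (h : HasSignature φ s 0 0) : IsMultiple s φ := by
  obtain ⟨e, he⟩ := h
  have : Unique ((Fin 0 → Fin n → ℂ) × (Fin 0 → ℂ)) := uniqueOfSubsingleton 0
  exact ⟨e ≪≫ₗ LinearEquiv.prodUnique, fun x v t => congrFun (congrArg Prod.fst (he x v)) t⟩

namespace Fock

/-- The `sl(k+1)`-action is transported along an isomorphism `E` assembled from those of `f`, `ρ`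
and the branching. This choice makes the square commute exactly, not just up to conjugation. -/
theorem Models.exists_succ {k N N' s : ℕ} {a b : ℕ → ℕ} {ρ : sl (Fin k) ℂ →ₗ⁅ℂ⁆ sl (Fin N) ℂ}
    (hρ : Models a ρ) {f : sl (Fin N) ℂ →ₗ⁅ℂ⁆ sl (Fin N') ℂ} (hf : IsMultiple s f)
    (h : ∀ j ≤ k, b j + b (j + 1) = s * a j) :
    ∃ ρ' : sl (Fin (k + 1)) ℂ →ₗ⁅ℂ⁆ sl (Fin N') ℂ, Models b ρ' ∧
      ∀ x, ρ' (slCorner k x) = f (ρ x) := by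
  obtain ⟨e, he⟩ := hρ
  obtain ⟨d, hd⟩ := hf
  obtain ⟨π, hπ⟩ := exists_branching h
  let E : (Fin N' → ℂ) ≃ₗ[ℂ] (Amp (k + 1) b → ℂ) :=
    d ≪≫ₗ LinearEquiv.piCongrRight (fun _ => e) ≪≫ₗ
      (LinearEquiv.curry ℂ ℂ (Fin s) (Amp k a)).symm ≪≫ₗ LinearEquiv.funCongrLeft ℂ ℂ π.symm
  have hE (v : Fin N' → ℂ) (p : Fin s × Amp k a) : E v (π p) = e (d v p.1) p.2 := by
    simp only [E, LinearEquiv.trans_apply, LinearEquiv.funCongrLeft_apply, LinearMap.funLeft_apply,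
      Equiv.symm_apply_apply]
    rfl
  obtain ⟨ρ', hρ'⟩ := exists_lieHom_of_linearEquiv E
  refine ⟨ρ', ⟨E, hρ'⟩, fun x => Subtype.ext (Matrix.ext_of_mulVec_single fun i => E.injective ?_)⟩
  rw [hρ', spin_slCorner]
  generalize (Pi.single i 1 : Fin N' → ℂ) = v
  ext q
  obtain ⟨p, rfl⟩ := π.surjective q
  rw [hE, hd, he]
  simp only [Matrix.mulVec, dotProduct]
  rw [← π.sum_comp]
  simp only [hπ _ (isGraded_spin x.1), hE, Fintype.sum_prod_type]
  rw [Finset.sum_eq_single p.1]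
  · simp
  · intro t _ ht
    simp [ht.symm]
  · simp

end Fock

/-! ### Homomorphisms into and out of sequential limits -/

section SeqLimit

variable {G : ℕ → Type*} [∀ k, LieRing (G k)] [∀ k, LieAlgebra ℂ (G k)]
  (f : ∀ k, G k →ₗ⁅ℂ⁆ G (k + 1))

theorem seqTrans_self (i : ℕ) : seqTrans f i i le_rfl = LieHom.id := by
  simp [seqTrans]

theorem seqTrans_succ {i j : ℕ} (h : i ≤ j) :
    seqTrans f i (j + 1) (h.trans (Nat.le_succ j)) = (f j).comp (seqTrans f i j h) := by
  simp only [seqTrans]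
  rw [Nat.leRec_succ (h1 := h)]

theorem seqTrans_injective (hf : ∀ i, Function.Injective (f i)) {i j : ℕ} (h : i ≤ j) :
    Function.Injective (seqTrans f i j h) := by
  induction h with
  | refl => rw [seqTrans_self]; exact Function.injective_id
  | step h ih => rw [seqTrans_succ f h]; exact (hf _).comp ih

theorem apply_seqTrans {C : Type*} (g : ∀ i, G i → C) (hg : ∀ i x, g (i + 1) (f i x) = g i x)
    {i j : ℕ} (h : i ≤ j) (x : G i) : g j (seqTrans f i j h x) = g i x := by
  induction h with
  | refl => rw [seqTrans_self]; rfl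
  | step h ih => rw [seqTrans_succ f h, LieHom.comp_apply, hg, ih]

namespace LieSeqLimit

/-- The map `G k → LieSeqLimit f` as a homomorphism of Lie algebras. -/
def mkHom (k : ℕ) : G k →ₗ⁅ℂ⁆ LieSeqLimit f where
  toFun := mk f k
  map_add' x y := (mk_add f k x y).symm
  map_smul' _ _ := rfl
  map_lie' := (mk_lie f k _ _).symm

theorem mkHom_injective (hf : ∀ i, Function.Injective (f i)) (k : ℕ) :
    Function.Injective (mkHom f k) :=
  DirectLimit.mk_injective (seqTrans f) (fun _ _ h => seqTrans_injective f hf h) k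

theorem mkHom_succ (k : ℕ) (x : G k) : mkHom f (k + 1) (f k x) = mkHom f k x := by
  have h : f k x = seqTrans f k (k + 1) (Nat.le_succ k) x := by
    rw [seqTrans_succ f le_rfl, seqTrans_self]
    rfl
  rw [h]
  exact (DirectLimit.eq_of_le (f := seqTrans f) ⟨k, x⟩ (k + 1) (Nat.le_succ k)).symm

/-- A compatible family of injective homomorphisms out of the algebras `G k` gives an injective
homomorphism out of the limit. -/
theorem exists_injective_lieHom {L : Type*} [LieRing L] [LieAlgebra ℂ L] (g : ∀ k, G k →ₗ⁅ℂ⁆ L)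
    (hg : ∀ k x, g (k + 1) (f k x) = g k x) (hinj : ∀ k, Function.Injective (g k)) :
    ∃ φ : LieSeqLimit f →ₗ⁅ℂ⁆ L, Function.Injective φ := by
  have hc (i j : ℕ) (h : i ≤ j) (x : G i) : g i x = g j (seqTrans f i j h x) :=
    (apply_seqTrans f (fun k x => g k x) hg h x).symm
  let F : LieSeqLimit f → L := DirectLimit.lift (seqTrans f) (fun k x => g k x) hc
  have hF (k : ℕ) (x : G k) : F (mk f k x) = g k x := rfl
  have hlie : ∀ x y, F ⁅x, y⁆ = ⁅F x, F y⁆ :=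
    DirectLimit.induction₂ (seqTrans f) fun k x y => by
      change F ⁅mk f k x, mk f k y⁆ = ⁅F (mk f k x), F (mk f k y)⁆
      rw [mk_lie, hF, hF, hF, LieHom.map_lie]
  refine ⟨{ toFun := F, map_add' := ?_, map_smul' := ?_, map_lie' := hlie _ _ },
    DirectLimit.lift_injective (seqTrans f) _ hc hinj⟩
  · refine DirectLimit.induction₂ (seqTrans f) fun k x y => ?_
    change F (mk f k x + mk f k y) = F (mk f k x) + F (mk f k y)
    rw [mk_add, hF, hF, hF, map_add]
  · intro c
    refine DirectLimit.induction (seqTrans f) fun k x => ?_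
    change F (c • mk f k x) = c • F (mk f k x)
    rw [mk_smul, hF, hF, map_smul]

end LieSeqLimit

end SeqLimit

/-! ### Embedding `sl(∞)` along a chain of multiples -/

theorem IsMultiple.seqTrans {n s : ℕ → ℕ} {f : ∀ i, sl (Fin (n i)) ℂ →ₗ⁅ℂ⁆ sl (Fin (n (i + 1))) ℂ}
    (hf : ∀ i, IsMultiple (s i) (f i)) {i j : ℕ} (h : i ≤ j) :
    ∃ t, IsMultiple t (seqTrans f i j h) := by
  induction h with
  | refl => exact ⟨1, by rw [seqTrans_self]; exact IsMultiple.id _⟩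
  | step h ih =>
    obtain ⟨t, ht⟩ := ih
    exact ⟨_, by rw [seqTrans_succ f h]; exact (hf _).comp ht⟩

/-- If `L` contains a chain of algebras `sl(n i)` with unbounded `n i` and inclusions of
signatures `(s i, 0, 0)`, then `sl(∞)` embeds into `L`. -/
theorem exists_injective_of_isMultiple {n s : ℕ → ℕ} (hn : 0 < n 0) (hs : ∀ i, 0 < s i)
    (hunb : ∀ M, ∃ i, M < n i) {f : ∀ i, sl (Fin (n i)) ℂ →ₗ⁅ℂ⁆ sl (Fin (n (i + 1))) ℂ}
    (hf : ∀ i, IsMultiple (s i) (f i)) {L : Type*} [LieRing L] [LieAlgebra ℂ L]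
    (ι : ∀ i, sl (Fin (n i)) ℂ →ₗ⁅ℂ⁆ L) (hι : ∀ i, Function.Injective (ι i))
    (hc : ∀ i x, ι (i + 1) (f i x) = ι i x) :
    ∃ φ : SlInfinity →ₗ⁅ℂ⁆ L, Function.Injective φ := by
  have hpos (i : ℕ) : 0 < n i := by
    induction i with
    | zero => exact hn
    | succ i ih => rw [(hf i).eq_mul]; exact Nat.mul_pos (hs i) ih
  obtain ⟨i, a, hi, ha0, ha, hab⟩ := exists_multiplicities hpos
    (fun i => ⟨s i, by rw [(hf i).eq_mul, mul_comm]⟩) hunb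
  have step (k : ℕ) (ρ : sl (Fin k) ℂ →ₗ⁅ℂ⁆ sl (Fin (n (i k))) ℂ) (hρ : Fock.Models (a k) ρ) :
      ∃ ρ' : sl (Fin (k + 1)) ℂ →ₗ⁅ℂ⁆ sl (Fin (n (i (k + 1)))) ℂ, Fock.Models (a (k + 1)) ρ' ∧
        ∀ x, ρ' (slCorner k x) = seqTrans f (i k) (i (k + 1)) (hi k) (ρ x) := by
    obtain ⟨t, ht⟩ := IsMultiple.seqTrans hf (hi k)
    -- As `n (i (k + 1)) = t * n (i k)`, cancelling `n (i k)` in `hab` leaves the branching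
    -- condition.
    refine hρ.exists_succ ht fun j hj => Nat.eq_of_mul_eq_mul_left (hpos (i k)) ?_
    rw [hab k j hj, ht.eq_mul]
    ring
  choose! R hR hRc using step
  have base : ∃ ρ : sl (Fin 0) ℂ →ₗ⁅ℂ⁆ sl (Fin (n (i 0))) ℂ, Fock.Models (a 0) ρ := by
    rw [← ha0]
    exact Fock.exists_models_zero (a 0)
  obtain ⟨ρ₀, hρ₀⟩ := base
  let ρ (k : ℕ) : sl (Fin k) ℂ →ₗ⁅ℂ⁆ sl (Fin (n (i k))) ℂ := Nat.rec ρ₀ R k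
  have hρ (k : ℕ) : Fock.Models (a k) (ρ k) := by
    induction k with
    | zero => exact hρ₀
    | succ k ih => exact hR k _ ih
  refine LieSeqLimit.exists_injective_lieHom slCorner (fun k => (ι (i k)).comp (ρ k))
    (fun k x => ?_) fun k => (hι _).comp ((hρ k).injective (ha k))
  have h1 : ρ (k + 1) (slCorner k x) = seqTrans f (i k) (i (k + 1)) (hi k) (ρ k x) :=
    hRc k _ (hρ k) x
  rw [LieHom.comp_apply, LieHom.comp_apply, h1]
  exact apply_seqTrans f (fun i x => ι i x) hc (hi k) _

/-! ### The algebras `sl(Π)` -/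

theorem isMultiple_slBlock (n s : ℕ) : IsMultiple s (slBlock n s) := by
  refine ⟨LinearEquiv.funCongrLeft ℂ ℂ ((Equiv.prodComm (Fin s) (Fin n)).trans finProdFinEquiv) ≪≫ₗ
    LinearEquiv.curry ℂ ℂ (Fin s) (Fin n), fun x v t => ?_⟩
  ext p
  change Matrix.mulVec (slBlock n s x).1 v (finProdFinEquiv (p, t)) =
    ∑ q, x.1 p q * v (finProdFinEquiv (q, t))
  simp only [Matrix.mulVec, dotProduct]
  rw [← finProdFinEquiv.sum_comp, Fintype.sum_prod_type]
  refine Finset.sum_congr rfl fun q _ => ?_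
  simp only [slBlock, LieHom.coe_mk, Matrix.reindex_apply, Matrix.submatrix_apply,
    Equiv.symm_apply_apply, Matrix.blockDiagonal_apply]
  simp

theorem partialProd_pos {s : ℕ → ℕ} (hs : ∀ i, 0 < s i) (k : ℕ) : 0 < partialProd s k := by
  induction k with
  | zero => exact one_pos
  | succ k ih => exact Nat.mul_pos ih (hs k)

theorem partialProd_dvd (s : ℕ → ℕ) {i j : ℕ} (h : i ≤ j) : partialProd s i ∣ partialProd s j := by
  induction h with
  | refl => exact dvd_rfl
  | step _ ih => exact ih.trans (dvd_mul_right _ _)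

/-- If the partial products were bounded, all would divide the largest one, which would then equal
`stz s`. -/
theorem exists_lt_partialProd {s : ℕ → ℕ} (hs : ∀ i, 0 < s i) (h : (stz s).IsInfinite) (M : ℕ) :
    ∃ i, M < partialProd s i := by
  by_contra! hM
  obtain ⟨N, ⟨i, rfl⟩, hN⟩ : ∃ N ∈ Set.range (partialProd s), ∀ x ∈ Set.range (partialProd s),
      x ≤ N := by
    have hb : BddAbove (Set.range (partialProd s)) := ⟨M, by rintro _ ⟨i, rfl⟩; exact hM i⟩
    exact ⟨_, Nat.sSup_mem (Set.range_nonempty _) hb, fun x hx => le_csSup hb hx⟩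
  refine h ⟨partialProd s i, partialProd_pos hs i, funext fun p => le_antisymm ?_ ?_⟩
  · refine iSup_le fun j => ?_
    have := Fact.mk p.2
    have h1 : partialProd s (max i j) = partialProd s i :=
      le_antisymm (hN _ ⟨_, rfl⟩)
        (Nat.le_of_dvd (partialProd_pos hs _) (partialProd_dvd s (le_max_left _ _)))
    have h2 : partialProd s j ∣ partialProd s i := h1 ▸ partialProd_dvd s (le_max_right i j)
    exact Nat.cast_le.2 ((padicValNat_dvd_iff_le (partialProd_pos hs i).ne').1
      (pow_padicValNat_dvd.trans h2))
  · exact le_iSup (fun k => (padicValNat p (partialProd s k) : ℕ∞)) i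

/-! ### Pure one-sided algebras -/

namespace TripleSeq

variable (T : TripleSeq)

theorem s_pos (i : ℕ) : 0 < T.s i := Nat.add_pos_left (T.l_pos i) _

theorem n_pos (i : ℕ) : 0 < T.n i := by
  induction i with
  | zero => exact one_pos
  | succ i ih => exact Nat.add_pos_left (Nat.mul_pos (T.s_pos i) ih) _

variable {T}

/-- Equality of `δ j` and `δ (j + 1)` amounts to `n (j + 1) = s j * n j`. -/
theorem IsPure.exists_z_eq_zero (h : T.IsPure) : ∃ i, ∀ j, i ≤ j → T.z j = 0 := by
  obtain ⟨i, hi⟩ := h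
  refine ⟨i + 1, fun j hj => ?_⟩
  have h1 : T.delta j = T.delta (j + 1) := by rw [(hi j hj).1, (hi (j + 1) (by omega)).1]
  have hp : (partialProd T.s j : ℚ) ≠ 0 := by exact_mod_cast (partialProd_pos T.s_pos j).ne'
  have hn : (T.n j : ℚ) ≠ 0 := by exact_mod_cast (T.n_pos j).ne'
  have hn' : (T.n (j + 1) : ℚ) ≠ 0 := by exact_mod_cast (T.n_pos (j + 1)).ne'
  rw [delta, delta, div_eq_div_iff hn hn'] at h1
  have h2 : (partialProd T.s (j + 1) : ℚ) = partialProd T.s j * T.s j := by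
    exact_mod_cast rfl
  rw [h2, mul_assoc] at h1
  have h3 := mul_left_cancel₀ hp h1
  have h4 : T.n (j + 1) = T.s j * T.n j := by exact_mod_cast h3
  exact Nat.add_eq_left.1 h4

theorem IsOneSided.exists_r_eq_zero (h : T.IsOneSided) : ∃ i, ∀ j, i ≤ j → T.r j = 0 := by
  obtain ⟨i, hi⟩ := h
  refine ⟨i, fun j hj => ?_⟩
  have := hi j hj
  simp only [c, s] at this
  omega

end TripleSeq

/-- A finite independent set lies in a single `𝔰 i`, so it has at most `M * M` elements. -/
theorem finiteDimensional_of_exhaustion {L : Type*} [LieRing L] [LieAlgebra ℂ L]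
    {𝔰 : ℕ → LieSubalgebra ℂ L} (h𝔰 : Monotone 𝔰) (hex : ∀ x : L, ∃ i, x ∈ 𝔰 i) {n : ℕ → ℕ}
    (e : ∀ i, sl (Fin (n i)) ℂ ≃ₗ⁅ℂ⁆ 𝔰 i) {M : ℕ} (hM : ∀ i, n i ≤ M) :
    FiniteDimensional ℂ L := by
  have hrank : Module.rank ℂ L ≤ (M * M : ℕ) := by
    refine rank_le fun t ht => ?_
    obtain ⟨i, hi⟩ : ∃ i, ∀ x ∈ t, x ∈ 𝔰 i := by
      choose I hI using hex
      exact ⟨t.sup I, fun x hx => h𝔰 (Finset.le_sup hx) (hI x)⟩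
    let e' : sl (Fin (n i)) ℂ ≃ₗ[ℂ] (𝔰 i).toSubmodule := (e i).toLinearEquiv
    have hfin : FiniteDimensional ℂ (𝔰 i).toSubmodule := e'.finiteDimensional
    have h1 : Submodule.span ℂ (t : Set L) ≤ (𝔰 i).toSubmodule := Submodule.span_le.2 hi
    calc t.card = Module.finrank ℂ (Submodule.span ℂ (t : Set L)) :=
          (finrank_span_finset_eq_card ht).symm
      _ ≤ Module.finrank ℂ (𝔰 i).toSubmodule := Submodule.finrank_mono h1
      _ = Module.finrank ℂ (sl (Fin (n i)) ℂ).toSubmodule := e'.finrank_eq.symm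
      _ ≤ Module.finrank ℂ (Matrix (Fin (n i)) (Fin (n i)) ℂ) := Submodule.finrank_le _
      _ = n i * n i := by simp [Module.finrank_matrix]
      _ ≤ M * M := Nat.mul_le_mul (hM i) (hM i)
  exact Module.rank_lt_aleph0_iff.1 (hrank.trans_lt (Cardinal.natCast_lt_aleph0))

theorem IsPureOneSidedTypeA.exists_injective {L : Type*} [LieRing L] [LieAlgebra ℂ L]
    (hL : ¬ FiniteDimensional ℂ L) (h : IsPureOneSidedTypeA L) :
    ∃ φ : SlInfinity →ₗ⁅ℂ⁆ L, Function.Injective φ := by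
  obtain ⟨T, hpure, hone, 𝔰, h𝔰, e, hex, hsig⟩ := h
  obtain ⟨i₁, hz⟩ := hpure.exists_z_eq_zero
  obtain ⟨i₂, hr⟩ := hone.exists_r_eq_zero
  let m := max i₁ i₂
  have hmono : Monotone 𝔰 := monotone_nat_of_le_succ h𝔰
  -- Past index `m` every signature is `(l, 0, 0)`, and the tail of the chain still exhausts `L`.
  refine exists_injective_of_isMultiple (n := fun i => T.n (m + i)) (s := fun i => T.l (m + i))
    (T.n_pos _) (fun i => T.l_pos _) (fun M => ?_)
    (f := fun i => ((e (m + i + 1)).symm.toLieHom.comp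
      (LieSubalgebra.inclusion (h𝔰 (m + i)))).comp (e (m + i)).toLieHom)
    (fun i => HasSignature.isMultiple ?_)
    (fun i => (𝔰 (m + i)).incl.comp (e (m + i)).toLieHom)
    (fun i => Subtype.val_injective.comp (e (m + i)).injective) fun i x => ?_
  · by_contra! hM
    exact hL (finiteDimensional_of_exhaustion (𝔰 := fun i => 𝔰 (m + i))
      (fun i j hij => hmono (by omega))
      (fun x => (hex x).imp fun i hi => hmono (Nat.le_add_left i m) hi)
      (fun i => e (m + i)) hM)
  · have := hsig (m + i)
    rwa [hz _ (by omega), hr _ (by omega)] at this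
  · change (((e (m + i + 1)) ((e (m + i + 1)).symm
      (LieSubalgebra.inclusion (h𝔰 (m + i)) (e (m + i) x))) : 𝔰 (m + i + 1)) : L) = _
    rw [LieEquiv.apply_symm_apply]
    rfl

theorem mainTheorem4 :
    (∀ (L : Type*) [LieRing L] [LieAlgebra ℂ L],
      ¬ FiniteDimensional ℂ L → IsPureOneSidedTypeA L →
        ∃ φ : SlInfinity →ₗ⁅ℂ⁆ L, Function.Injective φ) ∧
    (∀ P : Steinitz, P.IsInfinite →
      ∀ s : ℕ → ℕ, (∀ i, 0 < s i) → stz s = P →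
        ∃ φ : SlInfinity →ₗ⁅ℂ⁆ SlStz s, Function.Injective φ) := by
  refine ⟨fun L _ _ hL h => h.exists_injective hL, fun P hP s hs hsP => ?_⟩
  subst hsP
  exact exists_injective_of_isMultiple (n := partialProd s) (s := s) one_pos hs
    (exists_lt_partialProd hs hP) (f := slStep s) (fun k => isMultiple_slBlock _ _)
    (LieSeqLimit.mkHom (slStep s))
    (LieSeqLimit.mkHom_injective _ fun k => (isMultiple_slBlock _ _).injective (hs k))
    (LieSeqLimit.mkHom_succ _)
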